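/- Let $G$ be a compact (Hausdorff topological) group, for example a compact Lie group, or a finite group with the discrete topology. Let $\mathcal H_{\rm in}$ and $\mathcal H_{\rm out}$ be complex Hilbert spaces carrying strongly continuous unitary representations $U_{\rm in}$ and $U_{\rm out}$ of $G$, and let $\psi\in\mathcal H_{\rm in}$ and $\phi\in\mathcal H_{\rm out}$ be unit vectors, with characteristic functions $\chi_\psi(g)=\langle\psi|U_{\rm in}(g)|\psi\rangle$ and $\chi_\phi(g)=\langle\phi|U_{\rm out}(g)|\phi\rangle$. A quantum channel is a linear, completely positive, trace-preserving map $\mathcal E$ from the trace-class operators on $\mathcal H_{\rm in}$ to those on $\mathcal H_{\rm out}$; it is $G$-covariant if $\mathcal E(U_{\rm in}(g)\,X\,U_{\rm in}(g)^\dagger)=U_{\rm out}(g)\,\mathcal E(X)\,U_{\rm out}(g)^\dagger$ for all $g\in G$ and all trace-class $X$. Then the following are equivalent: 1. there is a $G$-covariant quantum channel $\mathcal E$ with $\mathcal E(|\psi\rangle\langle\psi|)=|\phi\rangle\langle\phi|$; 2. there is a positive definite function $f:G\to\mathbb C$ (that is, for all $n\in\mathbb N$ and $g_1,\dots,g_n\in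 G$ the matrix $\big(f(g_i^{-1}g_j)\big)_{i,j}$ is positive semidefinite) such that $\chi_\psi(g)=\chi_\phi(g)\,f(g)$ for all $g\in G$. -/

import Mathlib

open scoped ComplexOrder InnerProductSpace

noncomputable section

namespace CovariantConversion

/-! ### Trace-class operators and the trace -/

section TraceClass

variable (H : Type*) [NormedAddCommGroup H] [InnerProductSpace ℂ H] [CompleteSpace H]

/-- Index set of a fixed orthonormal (Hilbert) basis of `H`. -/
def basisIndex : Set H := (exists_hilbertBasis ℂ H).choose

/-- A fixed orthonormal basis of `H`. The notions below do not depend on it: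
see `hasSum_trace`. -/
def onb : HilbertBasis (basisIndex H) ℂ H := (exists_hilbertBasis ℂ H).choose_spec.choose

/-- Positive bounded operators with finite trace. -/
def positiveTraceClass : Set (H →L[ℂ] H) :=
  {T | T.IsPositive ∧ Summable fun i => (⟪onb H i, T (onb H i)⟫_ℂ).re}

/-- The trace-class operators on `H`: the complex linear span of the positive bounded operators
with finite trace. -/
def traceClass : Submodule ℂ (H →L[ℂ] H) := Submodule.span ℂ (positiveTraceClass H)

variable {H}

/-- The trace `∑ᵢ ⟨eᵢ, T eᵢ⟩` of a trace-class operator. -/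
def trace (T : traceClass H) : ℂ := ∑' i, ⟪onb H i, T.1 (onb H i)⟫_ℂ

theorem tsum_enorm_sq {ι : Type*} (c : HilbertBasis ι ℂ H) (x : H) :
    ∑' k, ENNReal.ofReal (‖⟪c k, x⟫_ℂ‖ ^ 2) = ENNReal.ofReal (‖x‖ ^ 2) := by
  have h := (c.hasSum_inner_mul_inner x x).mapL Complex.reCLM
  have h2 : HasSum (fun k => ‖⟪c k, x⟫_ℂ‖ ^ 2) (‖x‖ ^ 2) := by
    convert h using 1
    · funext k
      rw [← inner_conj_symm x (c k)]
      simp [← Complex.normSq_eq_conj_mul_self, Complex.normSq_eq_norm_sq, -inner_conj_symm]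
      norm_cast
    · simp [inner_self_eq_norm_sq_to_K, ← Complex.ofReal_pow]
  rw [← h2.tsum_eq, ENNReal.ofReal_tsum_of_nonneg (fun _ => by positivity) h2.summable]

theorem tsum_norm_sq_swap {ι κ : Type*} (b : HilbertBasis ι ℂ H) (c : HilbertBasis κ ℂ H)
    (S : H →L[ℂ] H) :
    ∑' i, ENNReal.ofReal (‖S (b i)‖ ^ 2) =
      ∑' k, ENNReal.ofReal (‖ContinuousLinearMap.adjoint S (c k)‖ ^ 2) := by
  simp_rw [← tsum_enorm_sq c (S _), ← tsum_enorm_sq b (ContinuousLinearMap.adjoint S _)]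
  rw [ENNReal.tsum_comm]
  refine tsum_congr fun k => tsum_congr fun i => ?_
  rw [ContinuousLinearMap.adjoint_inner_right, norm_inner_symm]

theorem tsum_trace_eq {ι κ : Type*} (b : HilbertBasis ι ℂ H) (c : HilbertBasis κ ℂ H)
    {T : H →L[ℂ] H} (hT : T.IsPositive) :
    ∑' i, ENNReal.ofReal (⟪b i, T (b i)⟫_ℂ).re = ∑' k, ENNReal.ofReal (⟪c k, T (c k)⟫_ℂ).re := by
  have hn : 0 ≤ T := (ContinuousLinearMap.nonneg_iff_isPositive T).2 hT
  have hS : IsSelfAdjoint (CFC.sqrt T) := IsSelfAdjoint.of_nonneg (CFC.sqrt_nonneg T)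
  have hadj : ContinuousLinearMap.adjoint (CFC.sqrt T) = CFC.sqrt T := hS
  have key : ∀ x : H, (⟪x, T x⟫_ℂ).re = ‖CFC.sqrt T x‖ ^ 2 := by
    intro x
    conv_lhs => rw [← CFC.sqrt_mul_sqrt_self T hn]
    rw [mul_apply_eq_comp, ← ContinuousLinearMap.adjoint_inner_left, hadj]
    simp [inner_self_eq_norm_sq_to_K, ← Complex.ofReal_pow]
  simp_rw [key]
  rw [tsum_norm_sq_swap b c, hadj]

theorem re_inner_nonneg {T : H →L[ℂ] H} (hT : T.IsPositive) (x : H) :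
    0 ≤ (⟪x, T x⟫_ℂ).re := hT.re_inner_nonneg_right x

theorem summable_of_mem {κ : Type*} (c : HilbertBasis κ ℂ H) {T : H →L[ℂ] H}
    (hT : T ∈ positiveTraceClass H) : Summable fun k => (⟪c k, T (c k)⟫_ℂ).re := by
  have h := hT.2.tsum_ofReal_ne_top
  rw [tsum_trace_eq (onb H) c hT.1] at h
  have := ENNReal.summable_toReal h
  simpa [ENNReal.toReal_ofReal (re_inner_nonneg hT.1 _)] using this

/-- The diagonal series of a trace-class operator converges in every orthonormal basis, and its
sum is the trace. -/
theorem hasSum_trace {κ : Type*} (c : HilbertBasis κ ℂ H) (T : traceClass H) :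
    HasSum (fun k => ⟪c k, T.1 (c k)⟫_ℂ) (trace T) := by
  suffices h : ∀ T ∈ traceClass H, ∃ t : ℂ, HasSum (fun i => ⟪onb H i, T (onb H i)⟫_ℂ) t ∧
      HasSum (fun k => ⟪c k, T (c k)⟫_ℂ) t by
    obtain ⟨t, h1, h2⟩ := h T.1 T.2
    rw [trace, h1.tsum_eq]
    exact h2
  intro T hT
  induction hT using Submodule.span_induction with
  | mem T hT =>
    have hre : ∀ x : H, ((⟪x, T x⟫_ℂ).re : ℂ) = ⟪x, T x⟫_ℂ := fun x =>
      (Complex.eq_re_of_ofReal_le (hT.1.inner_nonneg_right x)).symm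
    have e : ∑' i, (⟪onb H i, T (onb H i)⟫_ℂ).re = ∑' k, (⟪c k, T (c k)⟫_ℂ).re := by
      have h := tsum_trace_eq (onb H) c hT.1
      rw [← ENNReal.ofReal_tsum_of_nonneg (fun _ => re_inner_nonneg hT.1 _) hT.2,
        ← ENNReal.ofReal_tsum_of_nonneg (fun _ => re_inner_nonneg hT.1 _)
          (summable_of_mem c hT)] at h
      exact (ENNReal.ofReal_eq_ofReal_iff (tsum_nonneg fun _ => re_inner_nonneg hT.1 _)
        (tsum_nonneg fun _ => re_inner_nonneg hT.1 _)).1 h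
    refine ⟨((∑' i, (⟪onb H i, T (onb H i)⟫_ℂ).re : ℝ) : ℂ), ?_, ?_⟩
    · simpa only [hre] using Complex.hasSum_ofReal.2 hT.2.hasSum
    · rw [e]
      simpa only [hre] using Complex.hasSum_ofReal.2 (summable_of_mem c hT).hasSum
  | zero => exact ⟨0, by simp [hasSum_zero], by simp [hasSum_zero]⟩
  | add S T _ _ hS hT =>
    obtain ⟨s, hs1, hs2⟩ := hS
    obtain ⟨t, ht1, ht2⟩ := hT
    exact ⟨s + t, by simpa [inner_add_right] using hs1.add ht1,
      by simpa [inner_add_right] using hs2.add ht2⟩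
  | smul a T _ hT =>
    obtain ⟨t, ht1, ht2⟩ := hT
    exact ⟨a * t, by simpa [inner_smul_right] using ht1.mul_left a,
      by simpa [inner_smul_right] using ht2.mul_left a⟩

/-- The rank-one operator `|ψ⟩⟨ψ|` is trace class. -/
theorem rankOne_mem (ψ : H) : InnerProductSpace.rankOne ℂ ψ ψ ∈ traceClass H := by
  refine Submodule.subset_span ⟨InnerProductSpace.isPositive_rankOne_self ψ, ?_⟩
  have h := ((onb H).hasSum_inner_mul_inner ψ ψ).mapL Complex.reCLM
  simpa [inner_smul_right, mul_comm] using h.summable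

/-- The operator `|ψ⟩⟨ψ|`; for a unit vector `ψ` this is the density operator of the
pure state `ψ`. -/
def pureState (ψ : H) : traceClass H := ⟨InnerProductSpace.rankOne ℂ ψ ψ, rankOne_mem ψ⟩

theorem unitary_conj_mem (u : unitary (H →L[ℂ] H)) {T : H →L[ℂ] H} (hT : T ∈ traceClass H) :
    (u : H →L[ℂ] H) * T * star (u : H →L[ℂ] H) ∈ traceClass H := by
  induction hT using Submodule.span_induction with
  | mem T hT =>
    refine Submodule.subset_span ⟨?_, ?_⟩
    · exact hT.1.conj_adjoint (u : H →L[ℂ] H)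
    · let e : H ≃ₗᵢ[ℂ] H := Unitary.linearIsometryEquiv u
      let c : HilbertBasis (basisIndex H) ℂ H := ⟨e.trans (onb H).repr⟩
      have hc : ∀ i, c i = star (u : H →L[ℂ] H) (onb H i) := by
        intro i
        rfl
      have := summable_of_mem c hT
      simp_rw [hc] at this
      convert this using 3 with i
      rw [mul_apply_eq_comp, mul_apply_eq_comp,
        ← ContinuousLinearMap.adjoint_inner_left]
      rfl
  | zero => simp
  | add S T _ _ hS hT => simpa [mul_add, add_mul] using add_mem hS hT
  | smul a T _ hT => simpa using Submodule.smul_mem _ a hT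

/-- Conjugation `T ↦ u T u†` of a trace-class operator by a unitary operator. -/
def conj (u : unitary (H →L[ℂ] H)) (T : traceClass H) : traceClass H :=
  ⟨(u : H →L[ℂ] H) * T.1 * star (u : H →L[ℂ] H), unitary_conj_mem u T.2⟩

end TraceClass

/-! ### Quantum channels -/

section Channel

variable {H K : Type*} [NormedAddCommGroup H] [InnerProductSpace ℂ H] [CompleteSpace H]
  [NormedAddCommGroup K] [InnerProductSpace ℂ K] [CompleteSpace K]

/-- An `n × n` matrix of trace-class operators on `H` is positive, as an operator on the `n`-fold
direct sum of `H`. -/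
def BlockPositive {n : ℕ} (A : Matrix (Fin n) (Fin n) (traceClass H)) : Prop :=
  ∀ x : Fin n → H, 0 ≤ ∑ i, ∑ j, ⟪x i, (A i j).1 (x j)⟫_ℂ

/-- A linear map between spaces of trace-class operators is completely positive if for every `n`
its entrywise application preserves positivity of `n × n` operator matrices. -/
def IsCompletelyPositive (E : traceClass H →ₗ[ℂ] traceClass K) : Prop :=
  ∀ (n : ℕ) (A : Matrix (Fin n) (Fin n) (traceClass H)), BlockPositive A → BlockPositive (A.map E)

/-- A quantum channel: linear, completely positive and trace preserving. -/
def IsQuantumChannel (E : traceClass H →ₗ[ℂ] traceClass K) : Prop :=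
  IsCompletelyPositive E ∧ ∀ T, trace (E T) = trace T

end Channel

/-! ### Symmetry -/

section Symmetry

/-- A (strongly continuous) unitary representation of a topological group on a Hilbert space. -/
structure UnitaryRep (G : Type*) [Group G] [TopologicalSpace G] (H : Type*)
    [NormedAddCommGroup H] [InnerProductSpace ℂ H] [CompleteSpace H] where
  toHom : G →* unitary (H →L[ℂ] H)
  continuous_apply : ∀ x : H, Continuous fun g => (toHom g : H →L[ℂ] H) x

variable {G : Type*} [Group G] [TopologicalSpace G]
  {H K : Type*} [NormedAddCommGroup H] [InnerProductSpace ℂ H] [CompleteSpace H]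
  [NormedAddCommGroup K] [InnerProductSpace ℂ K] [CompleteSpace K]

/-- `E (U(g) T U(g)†) = V(g) E(T) V(g)†` for all `g` and `T`. -/
def IsCovariant (U : UnitaryRep G H) (V : UnitaryRep G K)
    (E : traceClass H →ₗ[ℂ] traceClass K) : Prop :=
  ∀ (g : G) (T : traceClass H), E (conj (U.toHom g) T) = conj (V.toHom g) (E T)

/-- The state `ρ` evolves to `σ` under some `G`-covariant quantum channel. -/
def CovariantlyConvertible (U : UnitaryRep G H) (V : UnitaryRep G K)
    (ρ : traceClass H) (σ : traceClass K) : Prop :=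
  ∃ E : traceClass H →ₗ[ℂ] traceClass K, IsQuantumChannel E ∧ IsCovariant U V E ∧ E ρ = σ

/-- The characteristic function `χ_ψ(g) = ⟨ψ, U(g) ψ⟩`. -/
def charFn (U : UnitaryRep G H) (ψ : H) (g : G) : ℂ := ⟪ψ, (U.toHom g : H →L[ℂ] H) ψ⟫_ℂ

/-- A function on a group is positive definite if all matrices `(f (gᵢ⁻¹ gⱼ))ᵢⱼ` are
positive semidefinite. -/
def IsPositiveDefinite {G : Type*} [Group G] (f : G → ℂ) : Prop :=
  ∀ (n : ℕ) (g : Fin n → G), (Matrix.of fun i j => f ((g i)⁻¹ * g j)).PosSemidef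

end Symmetry

end CovariantConversion

end

/-!
A covariant channel `E` taking `ψ` to `φ` takes `U g ψ` to `V g φ`. Complete positivity then forces
`E (|U g ψ⟩⟨ψ|)` to be a multiple `f g` of `|V g φ⟩⟨φ|`; the matrices `f (gᵢ⁻¹ gⱼ)` are compressions
of a positive block operator, and comparing traces gives `χ_ψ = χ_φ f`.

Conversely, write `f (g⁻¹ h) = ⟪η g, η h⟫`. Then `U g ψ ↦ η g ⊗ V g φ` preserves inner products, so
it extends to an isometry of the cyclic subspace of `ψ` into `ℓ² ⊗ K`. Tracing out `ℓ²` gives a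
covariant map on that subspace. The orthogonal complement is measured and replaced by an invariant
state of `V`, which for a compact group is the Haar average of the orbit of `φ`.
-/

noncomputable section

namespace CovariantConversion

open InnerProductSpace ContinuousLinearMap

section UnitaryRep

variable {G : Type*} [Group G] [TopologicalSpace G]
  {H : Type*} [NormedAddCommGroup H] [InnerProductSpace ℂ H] [CompleteSpace H]

/-- The operator `U(g)`; the coercion lets it be written `U g`. -/
def UnitaryRep.op (U : UnitaryRep G H) (g : G) : H →L[ℂ] H := U.toHom g

instance : CoeFun (UnitaryRep G H) fun _ => G → H →L[ℂ] H := ⟨UnitaryRep.op⟩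

namespace UnitaryRep

theorem mul_apply (U : UnitaryRep G H) (g h : G) (x : H) : U (g * h) x = U g (U h x) := by
  rw [op, map_mul]
  rfl

theorem one_apply (U : UnitaryRep G H) (x : H) : U 1 x = x := by
  rw [op, map_one]
  rfl

theorem norm_apply (U : UnitaryRep G H) (g : G) (x : H) : ‖U g x‖ = ‖x‖ :=
  Unitary.norm_map (U.toHom g) x

theorem star_toHom (U : UnitaryRep G H) (g : G) :
    star (U.toHom g : H →L[ℂ] H) = U g⁻¹ := by
  rw [op, map_inv]
  rfl

theorem inner_apply_left (U : UnitaryRep G H) (g : G) (x y : H) :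
    ⟪U g x, y⟫_ℂ = ⟪x, U g⁻¹ y⟫_ℂ := by
  rw [← star_toHom, star_eq_adjoint, adjoint_inner_right]
  rfl

theorem inner_apply_apply (U : UnitaryRep G H) (g h : G) (x : H) :
    ⟪U g x, U h x⟫_ℂ = charFn U x (g⁻¹ * h) := by
  rw [U.inner_apply_left, ← U.mul_apply]
  rfl

end UnitaryRep

theorem charFn_one (U : UnitaryRep G H) {x : H} (hx : ‖x‖ = 1) : charFn U x 1 = 1 :=
  (congrArg (inner ℂ x) (U.one_apply x)).trans (inner_self_eq_one_of_norm_eq_one hx)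

end UnitaryRep

section InnerProduct

variable {H : Type*} [NormedAddCommGroup H] [InnerProductSpace ℂ H]

theorem enorm_inner_le (x y : H) : ‖⟪x, y⟫_ℂ‖ₑ ≤ ‖x‖ₑ * ‖y‖ₑ := by
  simpa only [← ofReal_norm, ← ENNReal.ofReal_mul (norm_nonneg x)] using
    ENNReal.ofReal_le_ofReal (norm_inner_le_norm x y)

theorem enorm_inner_symm (x y : H) : ‖⟪x, y⟫_ℂ‖ₑ = ‖⟪y, x⟫_ℂ‖ₑ :=
  enorm_eq_iff_norm_eq.2 (norm_inner_symm x y)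

theorem ext_inner_self {S T : H →L[ℂ] H} (h : ∀ x, ⟪x, S x⟫_ℂ = ⟪x, T x⟫_ℂ) : S = T := by
  refine ContinuousLinearMap.coe_injective ((ext_inner_map _ _).1 fun x => ?_)
  simpa only [inner_conj_symm, coe_coe] using congrArg (starRingEnd ℂ) (h x)

theorem inner_sub_inner_smul_self {a : H} (ha : ‖a‖ = 1) (x : H) :
    ⟪a, x - ⟪a, x⟫_ℂ • a⟫_ℂ = 0 := by
  rw [inner_sub_right, inner_smul_right, inner_self_eq_one_of_norm_eq_one ha, mul_one, sub_self]

end InnerProduct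

section HilbertSchmidt

variable {H K : Type*} [NormedAddCommGroup H] [InnerProductSpace ℂ H] [CompleteSpace H]
  [NormedAddCommGroup K] [InnerProductSpace ℂ K] [CompleteSpace K]

theorem tsum_enorm_inner_sq {ι : Type*} (c : HilbertBasis ι ℂ H) (x : H) :
    ∑' k, ‖⟪c k, x⟫_ℂ‖ₑ ^ 2 = ‖x‖ₑ ^ 2 := by
  simpa only [ENNReal.ofReal_pow, norm_nonneg, ofReal_norm] using tsum_enorm_sq c x

/-- The squared Hilbert–Schmidt norm `∑ₗ ‖S eₗ‖²`, with value `⊤` when the series diverges. -/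
def hsNormSq (S : H →L[ℂ] K) : ENNReal := ∑' l, ‖S (onb H l)‖ₑ ^ 2

theorem hsNormSq_adjoint (S : H →L[ℂ] K) : hsNormSq (adjoint S) = hsNormSq S := by
  simp_rw [hsNormSq, ← tsum_enorm_inner_sq (onb H) (adjoint S _),
    ← tsum_enorm_inner_sq (onb K) (S _)]
  rw [ENNReal.tsum_comm]
  refine tsum_congr fun l => tsum_congr fun k => ?_
  rw [adjoint_inner_right, enorm_inner_symm]

theorem enorm_apply_sq_le_hsNormSq (S : H →L[ℂ] K) (x : H) :
    ‖S x‖ₑ ^ 2 ≤ hsNormSq S * ‖x‖ₑ ^ 2 := by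
  rw [← tsum_enorm_inner_sq (onb K), ← hsNormSq_adjoint, hsNormSq, ← ENNReal.tsum_mul_right]
  refine ENNReal.tsum_le_tsum fun k => ?_
  rw [← adjoint_inner_left, ← mul_pow]
  gcongr
  exact enorm_inner_le _ _

theorem enorm_comp_adjoint_le (S : H →L[ℂ] K) : ‖S ∘L adjoint S‖ₑ ≤ hsNormSq S := by
  refine opENorm_le_bound _ fun y => (ENNReal.pow_le_pow_left_iff two_ne_zero).1 ?_
  calc ‖S (adjoint S y)‖ₑ ^ 2 ≤ hsNormSq S * (hsNormSq (adjoint S) * ‖y‖ₑ ^ 2) :=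
        (enorm_apply_sq_le_hsNormSq S _).trans (by
          gcongr
          exact enorm_apply_sq_le_hsNormSq _ y)
    _ = (hsNormSq S * ‖y‖ₑ) ^ 2 := by
        rw [hsNormSq_adjoint]
        ring

theorem inner_comp_adjoint_self (S : H →L[ℂ] K) (y : K) :
    ⟪y, (S ∘L adjoint S) y⟫_ℂ = ((‖adjoint S y‖ₑ ^ 2).toReal : ℂ) := by
  rw [comp_apply, ← adjoint_inner_left, inner_self_eq_norm_sq_to_K, ENNReal.toReal_pow,
    toReal_enorm, Complex.ofReal_pow]
  rfl

theorem hasSum_ofReal_toReal {ι : Type*} {F : ι → ENNReal} (hF : ∑' i, F i ≠ ⊤) :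
    HasSum (fun i => ((F i).toReal : ℂ)) ((∑' i, F i).toReal : ℂ) := by
  rw [ENNReal.tsum_toReal_eq (ENNReal.ne_top_of_tsum_ne_top hF)]
  exact Complex.hasSum_ofReal.2 (ENNReal.summable_toReal hF).hasSum

theorem hasSum_inner_comp_adjoint {S : H →L[ℂ] K} (hS : hsNormSq S ≠ ⊤) :
    HasSum (fun k => ⟪onb K k, (S ∘L adjoint S) (onb K k)⟫_ℂ) ((hsNormSq S).toReal : ℂ) := by
  rw [← hsNormSq_adjoint] at hS ⊢
  simp only [inner_comp_adjoint_self]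
  exact hasSum_ofReal_toReal hS

theorem mem_positiveTraceClass_of_hasSum {T : H →L[ℂ] H} (hT : T.IsPositive) {t : ℂ}
    (h : HasSum (fun i => ⟪onb H i, T (onb H i)⟫_ℂ) t) : T ∈ positiveTraceClass H :=
  ⟨hT, (h.mapL Complex.reCLM).summable⟩

/-- The trace-class operator `S S†` of a Hilbert–Schmidt operator `S`. -/
def mulAdjoint (S : H →L[ℂ] K) (hS : hsNormSq S ≠ ⊤) : traceClass K :=
  ⟨S ∘L adjoint S, Submodule.subset_span <|
    mem_positiveTraceClass_of_hasSum (isPositive_self_comp_adjoint S)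
      (hasSum_inner_comp_adjoint hS)⟩

theorem trace_mulAdjoint (S : H →L[ℂ] K) (hS : hsNormSq S ≠ ⊤) :
    trace (mulAdjoint S hS) = ((hsNormSq S).toReal : ℂ) :=
  (hasSum_inner_comp_adjoint hS).tsum_eq

theorem exists_eq_mulAdjoint {T : traceClass H} (hT : T.1.IsPositive) :
    ∃ (S : H →L[ℂ] H) (hS : hsNormSq S ≠ ⊤), T = mulAdjoint S hS := by
  have hadj : adjoint (CFC.sqrt T.1) = CFC.sqrt T.1 :=
    IsSelfAdjoint.of_nonneg (CFC.sqrt_nonneg T.1)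
  have hsqrt : T.1 = CFC.sqrt T.1 ∘L adjoint (CFC.sqrt T.1) := by
    rw [hadj]
    exact (CFC.sqrt_mul_sqrt_self T.1 ((nonneg_iff_isPositive T.1).2 hT)).symm
  have hfin : hsNormSq (CFC.sqrt T.1) ≠ ⊤ := by
    have hdiag : ∀ x, ⟪x, T.1 x⟫_ℂ = ((‖adjoint (CFC.sqrt T.1) x‖ₑ ^ 2).toReal : ℂ) := fun x =>
      (congrArg (fun A : H →L[ℂ] H => ⟪x, A x⟫_ℂ) hsqrt).trans (inner_comp_adjoint_self _ x)
    have h := ((hasSum_trace (onb H) T).mapL Complex.reCLM).summable.tsum_ofReal_ne_top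
    rw [← hsNormSq_adjoint, hsNormSq]
    simpa only [hdiag, Complex.reCLM_apply, Complex.ofReal_re,
      ENNReal.ofReal_toReal (ENNReal.pow_ne_top enorm_ne_top)] using h
  exact ⟨CFC.sqrt T.1, hfin, Subtype.ext hsqrt⟩

theorem linearMap_ext_mulAdjoint {M : Type*} [AddCommGroup M] [Module ℂ M]
    {E F : traceClass H →ₗ[ℂ] M}
    (h : ∀ (S : H →L[ℂ] H) (hS : hsNormSq S ≠ ⊤), E (mulAdjoint S hS) = F (mulAdjoint S hS)) :
    E = F := by
  refine LinearMap.ext_on (Submodule.span_span_coe_preimage (s := positiveTraceClass H)) ?_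
  intro T hT
  obtain ⟨S, hS, rfl⟩ := exists_eq_mulAdjoint hT.1
  exact h S hS

variable (H) in
/-- The trace as a linear functional on the trace-class operators. -/
def traceLinear : traceClass H →ₗ[ℂ] ℂ where
  toFun := trace
  map_add' S T := by
    refine (hasSum_trace (onb H) (S + T)).unique ?_
    simpa [inner_add_right] using (hasSum_trace (onb H) S).add (hasSum_trace (onb H) T)
  map_smul' a T := by
    refine (hasSum_trace (onb H) (a • T)).unique ?_
    simpa [inner_smul_right] using (hasSum_trace (onb H) T).mul_left a

/-- Conjugation by a unitary operator as a linear map on the trace-class operators. -/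
def conjLinear (u : unitary (H →L[ℂ] H)) : traceClass H →ₗ[ℂ] traceClass H where
  toFun := conj u
  map_add' S T := Subtype.ext (by simp [conj, mul_add, add_mul])
  map_smul' a T := Subtype.ext (by simp [conj])

theorem inner_conj_apply (u : unitary (H →L[ℂ] H)) (T : traceClass H) (x y : H) :
    ⟪x, (conj u T).1 y⟫_ℂ =
      ⟪star (u : H →L[ℂ] H) x, T.1 (star (u : H →L[ℂ] H) y)⟫_ℂ := by
  rw [star_eq_adjoint, adjoint_inner_left]
  rfl

theorem hsNormSq_unitary_comp (u : unitary (K →L[ℂ] K)) (S : H →L[ℂ] K) :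
    hsNormSq ((u : K →L[ℂ] K) ∘L S) = hsNormSq S := by
  simp only [hsNormSq, comp_apply, ← ofReal_norm, Unitary.norm_map]

theorem conj_mulAdjoint (u : unitary (K →L[ℂ] K)) (S : H →L[ℂ] K) (hS : hsNormSq S ≠ ⊤) :
    conj u (mulAdjoint S hS) = mulAdjoint ((u : K →L[ℂ] K) ∘L S)
      ((hsNormSq_unitary_comp u S).trans_ne hS) := by
  refine Subtype.ext ?_
  change (u : K →L[ℂ] K) ∘L (S ∘L adjoint S) ∘L adjoint (u : K →L[ℂ] K) = _ ∘L adjoint _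
  rw [adjoint_comp]
  rfl

end HilbertSchmidt

section KetBra

variable {H : Type*} [NormedAddCommGroup H] [InnerProductSpace ℂ H] [CompleteSpace H]

theorem rankOne_mem_traceClass (x y : H) : rankOne ℂ x y ∈ traceClass H := by
  have polarization : rankOne ℂ x y = (1 / 4 : ℂ) •
      (rankOne ℂ (x + y) (x + y) - rankOne ℂ (x - y) (x - y) +
        Complex.I • rankOne ℂ (x + Complex.I • y) (x + Complex.I • y) -
        Complex.I • rankOne ℂ (x - Complex.I • y) (x - Complex.I • y)) := by
    ext z
    simp only [rankOne_apply, smul_apply, sub_apply, add_apply, inner_add_left, inner_sub_left,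
      inner_smul_left, Complex.conj_I]
    match_scalars <;> ring_nf <;> simp only [Complex.I_sq] <;> ring
  rw [polarization]
  exact Submodule.smul_mem _ _ <| sub_mem
    (add_mem (sub_mem (rankOne_mem _) (rankOne_mem _)) (Submodule.smul_mem _ _ (rankOne_mem _)))
    (Submodule.smul_mem _ _ (rankOne_mem _))

/-- The trace-class operator `|x⟩⟨y|`. -/
def ketBra (x y : H) : traceClass H := ⟨rankOne ℂ x y, rankOne_mem_traceClass x y⟩

theorem ketBra_self (x : H) : ketBra x x = pureState x := rfl

theorem ketBra_apply (x y z : H) : (ketBra x y).1 z = ⟪y, z⟫_ℂ • x := rfl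

theorem trace_ketBra (x y : H) : trace (ketBra x y) = ⟪y, x⟫_ℂ := by
  refine (hasSum_trace (onb H) (ketBra x y)).unique ?_
  simpa only [ketBra_apply, inner_smul_right] using (onb H).hasSum_inner_mul_inner y x

theorem conj_ketBra (u : unitary (H →L[ℂ] H)) (x y : H) :
    conj u (ketBra x y) = ketBra ((u : H →L[ℂ] H) x) ((u : H →L[ℂ] H) y) := by
  ext z
  change (u : H →L[ℂ] H) (⟪y, star (u : H →L[ℂ] H) z⟫_ℂ • x) = _
  rw [map_smul, star_eq_adjoint, adjoint_inner_right]
  rfl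

end KetBra

section PositiveSemidefinite

open Matrix

theorem posSemidef_of_forall_sum_nonneg {ι : Type*} [Fintype ι] {M : Matrix ι ι ℂ}
    (hM : ∀ z : ι → ℂ, 0 ≤ ∑ i, ∑ j, star (z i) * M i j * z j) : M.PosSemidef := by
  classical
  rw [← isPositive_toEuclideanLin_iff, LinearMap.isPositive_iff_complex]
  intro x
  have h : ⟪M.toEuclideanLin x, x⟫_ℂ = star (∑ i, ∑ j, star (x i) * M i j * x j) := by
    simp only [PiLp.inner_apply, toLpLin_apply, mulVec, dotProduct, RCLike.inner_apply, map_sum,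
      map_mul, Finset.mul_sum, star_sum, star_mul', Complex.star_def, Complex.conj_conj]
    exact Finset.sum_congr rfl fun i _ => Finset.sum_congr rfl fun j _ => by ring
  rw [h, (IsSelfAdjoint.of_nonneg (hM x)).star_eq]
  exact ⟨(Complex.eq_re_of_ofReal_le (hM x)).symm, (Complex.le_def.1 (hM x)).1⟩

theorem apply_eq_zero_of_diag_right_eq_zero {ι : Type*} [Finite ι] {M : Matrix ι ι ℂ}
    (hM : M.PosSemidef) {i j : ι} (hj : M j j = 0) : M i j = 0 := by
  classical
  have := Fintype.ofFinite ι
  have h : M *ᵥ Pi.single j 1 = 0 := (hM.dotProduct_mulVec_zero_iff _).1 (by simp [hj])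
  simpa only [mulVec_single_one, col_apply, Pi.zero_apply] using congrFun h i

theorem apply_eq_zero_of_diag_left_eq_zero {ι : Type*} [Finite ι] {M : Matrix ι ι ℂ}
    (hM : M.PosSemidef) {i j : ι} (hi : M i i = 0) : M i j = 0 := by
  rw [← hM.isHermitian.apply, apply_eq_zero_of_diag_right_eq_zero hM hi, star_zero]

end PositiveSemidefinite

section BlockPositive

variable {H : Type*} [NormedAddCommGroup H] [InnerProductSpace ℂ H] [CompleteSpace H] {n : ℕ}

theorem blockPositive_ketBra (a : Fin n → H) :
    BlockPositive (Matrix.of fun i j => ketBra (a i) (a j)) := by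
  intro x
  have h : ∑ i, ∑ j, ⟪x i, ((Matrix.of fun i j => ketBra (a i) (a j)) i j).1 (x j)⟫_ℂ =
      star (∑ i, ⟪a i, x i⟫_ℂ) * ∑ j, ⟪a j, x j⟫_ℂ := by
    simp only [Matrix.of_apply, ketBra_apply, inner_smul_right, star_sum, Finset.sum_mul_sum]
    refine Finset.sum_congr rfl fun i _ => Finset.sum_congr rfl fun j _ => ?_
    rw [Complex.star_def, inner_conj_symm, mul_comm]
  rw [h]
  exact star_mul_self_nonneg _

variable {A : Matrix (Fin n) (Fin n) (traceClass H)}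

theorem BlockPositive.posSemidef_inner (hA : BlockPositive A) (x : Fin n → H) :
    (Matrix.of fun i j => ⟪x i, (A i j).1 (x j)⟫_ℂ).PosSemidef := by
  refine posSemidef_of_forall_sum_nonneg fun z => ?_
  convert hA fun i => z i • x i using 4 with i _ j _
  simp only [Matrix.of_apply, map_smul, inner_smul_left, inner_smul_right, Complex.star_def]
  ring

theorem BlockPositive.inner_eq_zero_of_left (hA : BlockPositive A) {i j : Fin n} (hij : i ≠ j)
    {x : H} (hx : ⟪x, (A i i).1 x⟫_ℂ = 0) (y : H) : ⟪x, (A i j).1 y⟫_ℂ = 0 := by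
  have h := hA.posSemidef_inner fun k => if k = i then x else y
  simpa [hij.symm] using apply_eq_zero_of_diag_left_eq_zero h (i := i) (j := j) (by simpa using hx)

theorem BlockPositive.inner_eq_zero_of_right (hA : BlockPositive A) {i j : Fin n} (hij : i ≠ j)
    {y : H} (hy : ⟪y, (A j j).1 y⟫_ℂ = 0) (x : H) : ⟪x, (A i j).1 y⟫_ℂ = 0 := by
  have h := hA.posSemidef_inner fun k => if k = i then x else y
  simpa [hij.symm] using
    apply_eq_zero_of_diag_right_eq_zero h (i := i) (j := j) (by simpa [hij.symm] using hy)

theorem BlockPositive.eq_smul_ketBra (hA : BlockPositive A) {i j : Fin n} (hij : i ≠ j) {a b : H}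
    (ha : ‖a‖ = 1) (hb : ‖b‖ = 1) (hi : A i i = pureState a) (hj : A j j = pureState b) :
    A i j = ⟪a, (A i j).1 b⟫_ℂ • ketBra a b := by
  have left (x y : H) : ⟪x, (A i j).1 y⟫_ℂ = ⟪x, a⟫_ℂ * ⟪a, (A i j).1 y⟫_ℂ := by
    have h := hA.inner_eq_zero_of_left hij (x := x - ⟪a, x⟫_ℂ • a) (by
      rw [hi, ← ketBra_self, ketBra_apply, inner_sub_inner_smul_self ha, zero_smul,
        inner_zero_right]) y
    rwa [inner_sub_left, inner_smul_left, inner_conj_symm, sub_eq_zero] at h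
  have right (y : H) : ⟪a, (A i j).1 y⟫_ℂ = ⟪b, y⟫_ℂ * ⟪a, (A i j).1 b⟫_ℂ := by
    have h := hA.inner_eq_zero_of_right hij (y := y - ⟪b, y⟫_ℂ • b) (by
      rw [hj, ← ketBra_self, ketBra_apply, inner_sub_inner_smul_self hb, zero_smul,
        inner_zero_right]) a
    rwa [map_sub, map_smul, inner_sub_right, inner_smul_right, sub_eq_zero] at h
  ext y
  refine ext_inner_left ℂ fun x => ?_
  rw [left, right]
  change _ = ⟪x, ⟪a, (A i j).1 b⟫_ℂ • ⟪b, y⟫_ℂ • a⟫_ℂ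
  rw [inner_smul_right, inner_smul_right]
  ring

end BlockPositive

section Coherence

variable {G : Type*} [Group G] [TopologicalSpace G] {H K : Type*}
  [NormedAddCommGroup H] [InnerProductSpace ℂ H] [CompleteSpace H]
  [NormedAddCommGroup K] [InnerProductSpace ℂ K] [CompleteSpace K]
  {U : UnitaryRep G H} {V : UnitaryRep G K} {E : traceClass H →ₗ[ℂ] traceClass K}

variable (U V E) in
/-- The coefficient of `E(|U(g)ψ⟩⟨ψ|)` along `|V(g)φ⟩⟨φ|`. It measures how much of the coherence
between the orbit points `U(g)ψ` and `ψ` survives the channel `E`. -/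
def coherenceFn (ψ : H) (φ : K) (g : G) : ℂ := ⟪V g φ, (E (ketBra (U g ψ) ψ)).1 φ⟫_ℂ

theorem IsCovariant.map_pureState (hE : IsCovariant U V E) {ψ : H} {φ : K}
    (h : E (pureState ψ) = pureState φ) (g : G) : E (pureState (U g ψ)) = pureState (V g φ) := by
  have hg := hE g (pureState ψ)
  rwa [h, ← ketBra_self, ← ketBra_self, conj_ketBra, conj_ketBra] at hg

theorem IsCovariant.inner_map_ketBra (hE : IsCovariant U V E) (ψ : H) (φ : K) (g h : G) :
    ⟪V h φ, (E (ketBra (U h ψ) (U g ψ))).1 (V g φ)⟫_ℂ = coherenceFn U V E ψ φ (g⁻¹ * h) := by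
  have hcov := congrArg (fun T : traceClass K => ⟪V h φ, T.1 (V g φ)⟫_ℂ)
    (hE g (ketBra (U (g⁻¹ * h) ψ) ψ))
  have hU : (U.toHom g : H →L[ℂ] H) (U (g⁻¹ * h) ψ) = U h ψ :=
    (U.mul_apply g (g⁻¹ * h) ψ).symm.trans (by rw [mul_inv_cancel_left])
  simp only [conj_ketBra, inner_conj_apply, V.star_toHom, hU, ← V.mul_apply, inv_mul_cancel,
    V.one_apply] at hcov
  exact hcov

theorem isPositiveDefinite_coherenceFn (hcp : IsCompletelyPositive E) (hcov : IsCovariant U V E)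
    (ψ : H) (φ : K) : IsPositiveDefinite (coherenceFn U V E ψ φ) := by
  intro n g
  have h := (hcp n _ (blockPositive_ketBra fun i => U (g i) ψ)).posSemidef_inner fun i => V (g i) φ
  simp only [Matrix.map_apply, Matrix.of_apply, hcov.inner_map_ketBra] at h
  exact h.transpose

theorem charFn_eq_mul_coherenceFn (hE : IsQuantumChannel E) (hcov : IsCovariant U V E) {ψ : H}
    {φ : K} (hφ : ‖φ‖ = 1) (h : E (pureState ψ) = pureState φ) (g : G) :
    charFn U ψ g = charFn V φ g * coherenceFn U V E ψ φ g := by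
  have hblock : E (ketBra (U g ψ) ψ) = coherenceFn U V E ψ φ g • ketBra (V g φ) φ :=
    (hE.1 2 _ (blockPositive_ketBra ![U g ψ, ψ])).eq_smul_ketBra zero_ne_one
      ((V.norm_apply g φ).trans hφ) hφ (hcov.map_pureState h g) h
  calc charFn U ψ g = trace (E (ketBra (U g ψ) ψ)) := by
        rw [hE.2, trace_ketBra]
        rfl
    _ = coherenceFn U V E ψ φ g * ⟪φ, V g φ⟫_ℂ := by
        rw [hblock, ← trace_ketBra]
        exact (traceLinear K).map_smul _ _
    _ = charFn V φ g * coherenceFn U V E ψ φ g := mul_comm _ _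

end Coherence

section Kraus

variable {H K ι : Type*} [NormedAddCommGroup H] [InnerProductSpace ℂ H]
  [NormedAddCommGroup K] [InnerProductSpace ℂ K]

/-- A family of Kraus operators: `∑ᵢ Wᵢ† Wᵢ = 1`, stated as `∑ᵢ ‖Wᵢ x‖² = ‖x‖²`. -/
def IsKrausFamily (W : ι → H →L[ℂ] K) : Prop := ∀ x, ∑' i, ‖W i x‖ₑ ^ 2 = ‖x‖ₑ ^ 2

/-- The diagonal matrix element `⟨y, E(|x⟩⟨x|) y⟩ = ∑ᵢ |⟨y, Wᵢ x⟩|²` of the channel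
`E(T) = ∑ᵢ Wᵢ T Wᵢ†`. -/
def krausForm (W : ι → H →L[ℂ] K) (x : H) (y : K) : ENNReal := ∑' i, ‖⟪y, W i x⟫_ℂ‖ₑ ^ 2

theorem krausForm_sumElim {κ : Type*} (W : ι → H →L[ℂ] K) (W' : κ → H →L[ℂ] K) (x : H) (y : K) :
    krausForm (Sum.elim W W') x y = krausForm W x y + krausForm W' x y :=
  Summable.tsum_sum ENNReal.summable ENNReal.summable

variable {W : ι → H →L[ℂ] K}

theorem IsKrausFamily.krausForm_le (hW : IsKrausFamily W) (x : H) (y : K) :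
    krausForm W x y ≤ ‖y‖ₑ ^ 2 * ‖x‖ₑ ^ 2 := by
  rw [← hW x, ← ENNReal.tsum_mul_left]
  refine ENNReal.tsum_le_tsum fun i => ?_
  rw [← mul_pow]
  gcongr
  exact enorm_inner_le _ _

theorem IsKrausFamily.tsum_krausForm_onb [CompleteSpace K] (hW : IsKrausFamily W) (x : H) :
    ∑' k, krausForm W x (onb K k) = ‖x‖ₑ ^ 2 := by
  simp only [krausForm]
  rw [ENNReal.tsum_comm, ← hW x]
  exact tsum_congr fun i => tsum_enorm_inner_sq (onb K) (W i x)

theorem IsKrausFamily.tsum_hsNormSq [CompleteSpace H] (hW : IsKrausFamily W) (S : H →L[ℂ] H) :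
    ∑' i, hsNormSq (W i ∘L S) = hsNormSq S := by
  simp only [hsNormSq, comp_apply]
  rw [ENNReal.tsum_comm]
  exact tsum_congr fun l => hW _

theorem IsKrausFamily.tsum_krausForm_ne_top [CompleteSpace H] (hW : IsKrausFamily W)
    {S : H →L[ℂ] H} (hS : hsNormSq S ≠ ⊤) (y : K) : ∑' l, krausForm W (S (onb H l)) y ≠ ⊤ := by
  have hy : ‖y‖ₑ ^ 2 ≠ ⊤ := ENNReal.pow_ne_top enorm_ne_top
  refine ne_top_of_le_ne_top (ENNReal.mul_ne_top hy hS) ?_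
  rw [hsNormSq, ← ENNReal.tsum_mul_left]
  exact ENNReal.tsum_le_tsum fun l => hW.krausForm_le _ y

variable [CompleteSpace H] [CompleteSpace K]

theorem comp_mulAdjoint_comp (A : H →L[ℂ] K) (S : H →L[ℂ] H) (hS : hsNormSq S ≠ ⊤) :
    A ∘L (mulAdjoint S hS).1 ∘L adjoint A = (A ∘L S) ∘L adjoint (A ∘L S) := by
  rw [adjoint_comp]
  rfl

namespace IsKrausFamily

theorem summable (hW : IsKrausFamily W) (T : traceClass H) :
    Summable fun i => W i ∘L T.1 ∘L adjoint (W i) := by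
  obtain ⟨T, hT⟩ := T
  induction hT using Submodule.span_induction with
  | mem T hT =>
    obtain ⟨S, hS, hTS⟩ := exists_eq_mulAdjoint (T := ⟨T, Submodule.subset_span hT⟩) hT.1
    obtain rfl : T = (mulAdjoint S hS).1 := congrArg Subtype.val hTS
    simp only [comp_mulAdjoint_comp]
    refine Summable.of_enorm (ne_top_of_le_ne_top hS ?_)
    exact (ENNReal.tsum_le_tsum fun i => enorm_comp_adjoint_le _).trans_eq (hW.tsum_hsNormSq S)
  | zero => simpa only [zero_comp, comp_zero] using summable_zero
  | add S T _ _ hS hT => simpa only [add_comp, comp_add] using hS.add hT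
  | smul a T _ hT => simpa only [smul_comp, comp_smul] using hT.const_smul a

/-- The linear map `T ↦ ∑ᵢ Wᵢ T Wᵢ†`, with values among the bounded operators. -/
def krausSum (hW : IsKrausFamily W) : traceClass H →ₗ[ℂ] K →L[ℂ] K where
  toFun T := ∑' i, W i ∘L T.1 ∘L adjoint (W i)
  map_add' S T := by
    simp only [Submodule.coe_add, add_comp, comp_add]
    exact (hW.summable S).tsum_add (hW.summable T)
  map_smul' a T := by
    simp only [Submodule.coe_smul, smul_comp, comp_smul]
    exact tsum_const_smul'' a

theorem hasSum_inner (hW : IsKrausFamily W) (T : traceClass H) (x y : K) :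
    HasSum (fun i => ⟪adjoint (W i) x, T.1 (adjoint (W i) y)⟫_ℂ) ⟪x, hW.krausSum T y⟫_ℂ := by
  simp only [adjoint_inner_left]
  exact ((hW.summable T).hasSum.mapL (ContinuousLinearMap.apply ℂ K y)).mapL (innerSL ℂ x)

theorem inner_krausSum_mulAdjoint (hW : IsKrausFamily W) (S : H →L[ℂ] H) (hS : hsNormSq S ≠ ⊤)
    (y : K) : ⟪y, hW.krausSum (mulAdjoint S hS) y⟫_ℂ =
      ((∑' l, krausForm W (S (onb H l)) y).toReal : ℂ) := by
  have hswap : ∑' i, ‖adjoint S (adjoint (W i) y)‖ₑ ^ 2 = ∑' l, krausForm W (S (onb H l)) y := by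
    simp only [krausForm]
    rw [ENNReal.tsum_comm]
    refine tsum_congr fun i => ?_
    rw [← tsum_enorm_inner_sq (onb H)]
    refine tsum_congr fun l => ?_
    rw [adjoint_inner_right, adjoint_inner_right, enorm_inner_symm]
  refine (hW.hasSum_inner (mulAdjoint S hS) y y).unique ?_
  rw [← hswap]
  exact (funext fun i => inner_comp_adjoint_self S (adjoint (W i) y)) ▸
    hasSum_ofReal_toReal (hswap.trans_ne (hW.tsum_krausForm_ne_top hS y))

theorem hasSum_inner_krausSum_mulAdjoint (hW : IsKrausFamily W) (S : H →L[ℂ] H)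
    (hS : hsNormSq S ≠ ⊤) :
    HasSum (fun k => ⟪onb K k, hW.krausSum (mulAdjoint S hS) (onb K k)⟫_ℂ)
      ((hsNormSq S).toReal : ℂ) := by
  have htotal : ∑' k, ∑' l, krausForm W (S (onb H l)) (onb K k) = hsNormSq S := by
    rw [ENNReal.tsum_comm]
    exact tsum_congr fun l => hW.tsum_krausForm_onb _
  simp only [inner_krausSum_mulAdjoint]
  rw [← htotal]
  exact hasSum_ofReal_toReal (htotal.trans_ne hS)

theorem krausSum_mulAdjoint_mem (hW : IsKrausFamily W) (S : H →L[ℂ] H) (hS : hsNormSq S ≠ ⊤) :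
    hW.krausSum (mulAdjoint S hS) ∈ positiveTraceClass K := by
  refine mem_positiveTraceClass_of_hasSum ((nonneg_iff_isPositive _).1 <| tsum_nonneg fun i => ?_)
    (hW.hasSum_inner_krausSum_mulAdjoint S hS)
  rw [comp_mulAdjoint_comp, nonneg_iff_isPositive]
  exact isPositive_self_comp_adjoint _

theorem krausSum_mem (hW : IsKrausFamily W) (T : traceClass H) :
    hW.krausSum T ∈ traceClass K := by
  have h : (traceClass K).mkQ ∘ₗ hW.krausSum = 0 := linearMap_ext_mulAdjoint fun S hS =>
    (Submodule.Quotient.mk_eq_zero _).2 (Submodule.subset_span (hW.krausSum_mulAdjoint_mem S hS))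
  exact (Submodule.Quotient.mk_eq_zero _).1 (LinearMap.congr_fun h T)

/-- The quantum channel `T ↦ ∑ᵢ Wᵢ T Wᵢ†` of a family of Kraus operators. -/
def channel (hW : IsKrausFamily W) : traceClass H →ₗ[ℂ] traceClass K :=
  hW.krausSum.codRestrict (traceClass K) hW.krausSum_mem

theorem isCompletelyPositive_channel (hW : IsKrausFamily W) : IsCompletelyPositive hW.channel := by
  intro n A hA x
  have h : HasSum (fun k => ∑ i, ∑ j, ⟪adjoint (W k) (x i), (A i j).1 (adjoint (W k) (x j))⟫_ℂ)
      (∑ i, ∑ j, ⟪x i, ((A.map hW.channel) i j).1 (x j)⟫_ℂ) :=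
    hasSum_sum fun i _ => hasSum_sum fun j _ => hW.hasSum_inner (A i j) (x i) (x j)
  exact h.nonneg fun k => hA fun i => adjoint (W k) (x i)

theorem trace_channel (hW : IsKrausFamily W) (T : traceClass H) :
    trace (hW.channel T) = trace T := by
  have h : traceLinear K ∘ₗ hW.channel = traceLinear H := linearMap_ext_mulAdjoint fun S hS =>
    (hW.hasSum_inner_krausSum_mulAdjoint S hS).tsum_eq.trans (trace_mulAdjoint S hS).symm
  exact LinearMap.congr_fun h T

theorem isQuantumChannel (hW : IsKrausFamily W) : IsQuantumChannel hW.channel :=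
  ⟨hW.isCompletelyPositive_channel, hW.trace_channel⟩

end IsKrausFamily

theorem inner_pureState_apply_self (x y : H) :
    ⟪y, (pureState x).1 y⟫_ℂ = ((‖⟪y, x⟫_ℂ‖ₑ ^ 2).toReal : ℂ) := by
  rw [← ketBra_self, ketBra_apply, inner_smul_right, ← inner_conj_symm, RCLike.conj_mul,
    ENNReal.toReal_pow, toReal_enorm, Complex.ofReal_pow]
  rfl

theorem IsKrausFamily.channel_pureState (hW : IsKrausFamily W) {x : H} {a : K}
    (h : ∀ y, krausForm W x y = ‖⟪y, a⟫_ℂ‖ₑ ^ 2) :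
    hW.channel (pureState x) = pureState a := by
  refine Subtype.ext (ext_inner_self fun y => (hW.hasSum_inner (pureState x) y y).unique ?_)
  simp_rw [inner_pureState_apply_self, adjoint_inner_left]
  rw [← h]
  exact hasSum_ofReal_toReal ((h y).trans_ne (ENNReal.pow_ne_top enorm_ne_top))

variable {G : Type*} [Group G] [TopologicalSpace G]

theorem IsKrausFamily.isCovariant_channel (hW : IsKrausFamily W) {U : UnitaryRep G H}
    {V : UnitaryRep G K} (h : ∀ g x y, krausForm W (U g x) (V g y) = krausForm W x y) :
    IsCovariant U V hW.channel := by
  intro g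
  have hinv (x : H) (y : K) : krausForm W (U g x) y = krausForm W x (V g⁻¹ y) := by
    rw [← h g x, ← V.mul_apply, mul_inv_cancel, V.one_apply]
  refine LinearMap.congr_fun (f := hW.channel ∘ₗ conjLinear (U.toHom g))
    (g := conjLinear (V.toHom g) ∘ₗ hW.channel) (linearMap_ext_mulAdjoint fun S hS => ?_)
  change hW.channel (conj _ _) = conj _ (hW.channel _)
  refine Subtype.ext (ext_inner_self fun y => ?_)
  rw [conj_mulAdjoint, inner_conj_apply, V.star_toHom]
  refine (hW.inner_krausSum_mulAdjoint _ _ y).trans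
    (Eq.trans ?_ (hW.inner_krausSum_mulAdjoint S hS _).symm)
  exact congrArg (fun t : ENNReal => (t.toReal : ℂ)) (tsum_congr fun l => hinv _ _)

end Kraus

section Gram

variable {X H M N : Type*} [NormedAddCommGroup H] [InnerProductSpace ℂ H]
  [NormedAddCommGroup M] [InnerProductSpace ℂ M] [NormedAddCommGroup N] [InnerProductSpace ℂ N]

theorem norm_linearCombination_eq {a : X → H} {b : X → N}
    (hab : ∀ x y, ⟪a x, a y⟫_ℂ = ⟪b x, b y⟫_ℂ) (c : X →₀ ℂ) :
    ‖Finsupp.linearCombination ℂ a c‖ = ‖Finsupp.linearCombination ℂ b c‖ := by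
  have h : ⟪Finsupp.linearCombination ℂ a c, Finsupp.linearCombination ℂ a c⟫_ℂ =
      ⟪Finsupp.linearCombination ℂ b c, Finsupp.linearCombination ℂ b c⟫_ℂ := by
    simp only [Finsupp.linearCombination_apply, Finsupp.sum_inner, Finsupp.inner_sum,
      inner_smul_left, inner_smul_right, hab]
  rw [norm_eq_sqrt_re_inner (𝕜 := ℂ), h, ← norm_eq_sqrt_re_inner]

/-- The closed linear span of a family of vectors. -/
def closedSpan (a : X → H) : Submodule ℂ H := (Submodule.span ℂ (Set.range a)).topologicalClosure

instance [CompleteSpace H] (a : X → H) : CompleteSpace (closedSpan a) :=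
  inferInstanceAs (CompleteSpace (Submodule.topologicalClosure _))

theorem isClosed_closedSpan (a : X → H) : IsClosed (closedSpan a : Set H) :=
  Submodule.isClosed_topologicalClosure _

theorem linearCombination_mem_closedSpan (a : X → H) (c : X →₀ ℂ) :
    Finsupp.linearCombination ℂ a c ∈ closedSpan a :=
  Submodule.le_topologicalClosure _ (Finsupp.mem_span_range_iff_exists_finsupp.2 ⟨c, rfl⟩)

theorem mem_closedSpan (a : X → H) (x : X) : a x ∈ closedSpan a :=
  Submodule.le_topologicalClosure _ (Submodule.subset_span ⟨x, rfl⟩)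

theorem closedSpan_induction {a : X → H} {p : H → Prop} (hp : IsClosed {v | p v})
    (h : ∀ c, p (Finsupp.linearCombination ℂ a c)) {v : H} (hv : v ∈ closedSpan a) : p v := by
  refine closure_minimal (fun z hz => ?_) hp hv
  obtain ⟨c, rfl⟩ := Finsupp.mem_span_range_iff_exists_finsupp.1 hz
  exact h c

theorem norm_apply_eq_of_inner_eq {a : X → H} {A : H →L[ℂ] M} {B : H →L[ℂ] N}
    (hab : ∀ x y, ⟪A (a x), A (a y)⟫_ℂ = ⟪B (a x), B (a y)⟫_ℂ) {v : H} (hv : v ∈ closedSpan a) :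
    ‖A v‖ = ‖B v‖ := by
  refine closedSpan_induction (p := fun v => ‖A v‖ = ‖B v‖)
    (isClosed_eq (by fun_prop) (by fun_prop)) (fun c => ?_) hv
  have h := norm_linearCombination_eq (a := A ∘ a) (b := B ∘ a) hab c
  rwa [← coe_coe, ← coe_coe B, ← LinearMap.map_finsupp_linearCombination,
    ← LinearMap.map_finsupp_linearCombination] at h

/-- The linear combinations of a family of vectors, as elements of its closed span. -/
def combination (a : X → H) : (X →₀ ℂ) →ₗ[ℂ] closedSpan a :=
  (Finsupp.linearCombination ℂ a).codRestrict _ (linearCombination_mem_closedSpan a)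

theorem combination_single (a : X → H) (x : X) :
    combination a (Finsupp.single x 1) = ⟨a x, mem_closedSpan a x⟩ :=
  Subtype.ext ((Finsupp.linearCombination_single ℂ 1 x).trans (one_smul ℂ _))

theorem denseRange_combination (a : X → H) : DenseRange (combination a) := by
  rintro ⟨v, hv⟩
  rw [closure_subtype]
  exact closedSpan_induction (p := (· ∈ closure (Subtype.val '' Set.range (combination a))))
    isClosed_closure (fun c => subset_closure ⟨combination a c, ⟨c, rfl⟩, rfl⟩) hv

theorem exists_isometry_closedSpan [CompleteSpace N] {a : X → H} {b : X → N}
    (hab : ∀ x y, ⟪a x, a y⟫_ℂ = ⟪b x, b y⟫_ℂ) :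
    ∃ A : closedSpan a →L[ℂ] N, (∀ x, A ⟨a x, mem_closedSpan a x⟩ = b x) ∧ ∀ v, ‖A v‖ = ‖v‖ := by
  have hdense := denseRange_combination a
  have hnorm (c : X →₀ ℂ) : ‖Finsupp.linearCombination ℂ b c‖ = ‖combination a c‖ :=
    (norm_linearCombination_eq hab c).symm
  let A : closedSpan a →L[ℂ] N := (Finsupp.linearCombination ℂ b).extendOfNorm (combination a)
  have hA (c : X →₀ ℂ) : A (combination a c) = Finsupp.linearCombination ℂ b c :=
    LinearMap.extendOfNorm_eq hdense ⟨1, fun c => by rw [hnorm, one_mul]⟩ c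
  refine ⟨A, fun x => ?_, fun v => ?_⟩
  · rw [← combination_single, hA, Finsupp.linearCombination_single, one_smul]
  · exact hdense.induction_on (p := fun v => ‖A v‖ = ‖v‖) v
      (isClosed_eq (by fun_prop) (by fun_prop)) fun c => by rw [hA, hnorm]

theorem exists_partialIsometry [CompleteSpace H] [CompleteSpace N] {a : X → H} {b : X → N}
    (hab : ∀ x y, ⟪a x, a y⟫_ℂ = ⟪b x, b y⟫_ℂ) :
    ∃ A : H →L[ℂ] N, (∀ x, A (a x) = b x) ∧ ∀ v, ‖A v‖ = ‖(closedSpan a).starProjection v‖ := by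
  obtain ⟨A, hA, hiso⟩ := exists_isometry_closedSpan hab
  refine ⟨A ∘L (closedSpan a).orthogonalProjectionOnto, fun x => ?_, fun v => ?_⟩
  · rw [comp_apply, ← hA]
    exact congrArg A (Submodule.orthogonalProjectionOnto_mem_subspace_eq_self
      (⟨a x, mem_closedSpan a x⟩ : closedSpan a))
  · rw [comp_apply, hiso, Submodule.starProjection_apply, Submodule.coe_norm]

end Gram

section Cyclic

variable {G : Type*} [Group G] [TopologicalSpace G]
  {H : Type*} [NormedAddCommGroup H] [InnerProductSpace ℂ H] [CompleteSpace H]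

/-- The smallest closed invariant subspace containing `ψ`. -/
def cyclicSubspace (U : UnitaryRep G H) (ψ : H) : Submodule ℂ H := closedSpan fun g => U g ψ

instance (U : UnitaryRep G H) (ψ : H) : CompleteSpace (cyclicSubspace U ψ) :=
  inferInstanceAs (CompleteSpace (closedSpan _))

theorem orbit_mem_cyclicSubspace (U : UnitaryRep G H) (ψ : H) (g : G) :
    U g ψ ∈ cyclicSubspace U ψ :=
  mem_closedSpan (fun g => U g ψ) g

theorem self_mem_cyclicSubspace (U : UnitaryRep G H) (ψ : H) : ψ ∈ cyclicSubspace U ψ := by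
  simpa only [U.one_apply] using orbit_mem_cyclicSubspace U ψ 1

theorem apply_mem_cyclicSubspace (U : UnitaryRep G H) (ψ : H) (g : G) {x : H}
    (hx : x ∈ cyclicSubspace U ψ) : U g x ∈ cyclicSubspace U ψ := by
  refine closedSpan_induction (p := (U g · ∈ cyclicSubspace U ψ))
    ((isClosed_closedSpan _).preimage (U g).continuous) (fun c => ?_) hx
  rw [Finsupp.linearCombination_apply, map_finsuppSum]
  refine sum_mem fun h _ => ?_
  simp only [map_smul, ← U.mul_apply]
  exact Submodule.smul_mem _ _ (orbit_mem_cyclicSubspace U ψ (g * h))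

theorem starProjection_cyclicSubspace_apply (U : UnitaryRep G H) (ψ : H) (g : G) (x : H) :
    (cyclicSubspace U ψ).starProjection (U g x) = U g ((cyclicSubspace U ψ).starProjection x) := by
  refine Submodule.eq_starProjection_of_mem_of_inner_eq_zero
    (apply_mem_cyclicSubspace U ψ g (Submodule.starProjection_apply_mem _ x)) fun w hw => ?_
  rw [← map_sub, U.inner_apply_left]
  exact Submodule.starProjection_inner_eq_zero _ _ (apply_mem_cyclicSubspace U ψ g⁻¹ hw)

end Cyclic

section SquareSummable

open scoped ENNReal lp

variable {J : Type*}

section Map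

variable {M N : Type*} [NormedAddCommGroup M] [NormedSpace ℂ M] [NormedAddCommGroup N]
  [NormedSpace ℂ N] {p : ℝ≥0∞}

theorem norm_apply_le_norm_opNorm_smul (T : M →L[ℂ] N) (v : M) : ‖T v‖ ≤ ‖(‖T‖ : ℂ) • v‖ := by
  simpa only [norm_smul, Complex.norm_real, norm_norm] using T.le_opNorm v

variable [Fact (1 ≤ p)]

/-- The operator `1 ⊗ T` on `ℓᵖ(J, M)`: entrywise application of `T`. -/
def lpMap (T : M →L[ℂ] N) : lp (fun _ : J => M) p →L[ℂ] lp (fun _ : J => N) p :=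
  LinearMap.mkContinuous
    { toFun f := ⟨fun j => T (f j), (lp.memℓp ((‖T‖ : ℂ) • f)).mono' fun j =>
        norm_apply_le_norm_opNorm_smul T (f j)⟩
      map_add' f g := lp.ext (funext fun j => T.map_add (f j) (g j))
      map_smul' a f := lp.ext (funext fun j => T.map_smul a (f j)) } ‖T‖ fun f => by
    have hp : p ≠ 0 := (zero_lt_one.trans_le Fact.out).ne'
    calc _ ≤ ‖(‖T‖ : ℂ) • f‖ :=
          lp.norm_mono hp fun j => norm_apply_le_norm_opNorm_smul T (f j)
      _ = ‖T‖ * ‖f‖ := by rw [norm_smul, Complex.norm_real, norm_norm]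

/-- The elementary tensor `m ⊗ v` in `ℓᵖ(J) ⊗ M = ℓᵖ(J, M)`. -/
def lpTensor (m : lp (fun _ : J => ℂ) p) (v : M) : lp (fun _ : J => M) p :=
  lpMap (toSpanSingleton ℂ v) m

theorem lpTensor_apply (m : lp (fun _ : J => ℂ) p) (v : M) (j : J) :
    lpTensor m v j = m j • v := rfl

end Map

variable {K : Type*} [NormedAddCommGroup K]

theorem tsum_enorm_sq_lp (f : lp (fun _ : J => K) 2) : ∑' j, ‖f j‖ₑ ^ 2 = ‖f‖ₑ ^ 2 := by
  have h : HasSum (fun j => ‖f j‖ ^ 2) (‖f‖ ^ 2) := by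
    simpa using lp.hasSum_norm (p := 2) (by norm_num) f
  simp only [← ofReal_norm, ← ENNReal.ofReal_pow (norm_nonneg _)]
  rw [← h.tsum_eq, ENNReal.ofReal_tsum_of_nonneg (fun _ => by positivity) h.summable]

variable [InnerProductSpace ℂ K]

theorem inner_lpTensor (m n : lp (fun _ : J => ℂ) 2) (v w : K) :
    ⟪lpTensor m v, lpTensor n w⟫_ℂ = ⟪m, n⟫_ℂ * ⟪v, w⟫_ℂ := by
  refine (lp.hasSum_inner (𝕜 := ℂ) _ _).unique ?_
  refine ((lp.hasSum_inner (𝕜 := ℂ) m n).mul_right ⟪v, w⟫_ℂ).congr_fun fun j => ?_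
  rw [lpTensor_apply, lpTensor_apply, inner_smul_left, inner_smul_right, RCLike.inner_apply]
  ring

theorem lpMap_innerSL_lpTensor (y : K) (m : lp (fun _ : J => ℂ) 2) (v : K) :
    lpMap (innerSL ℂ y) (lpTensor m v) = ⟪y, v⟫_ℂ • m := by
  ext j
  change ⟪y, m j • v⟫_ℂ = ⟪y, v⟫_ℂ * m j
  rw [inner_smul_right, mul_comm]

end SquareSummable

section Kernel

universe u

variable {X : Type u}

theorem posSemidef_of_forall_submatrix {k : Matrix X X ℂ}
    (hk : ∀ (n : ℕ) (x : Fin n → X), (k.submatrix x x).PosSemidef) : k.PosSemidef := by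
  refine ⟨Matrix.IsHermitian.ext fun x y => ?_, fun v => ?_⟩
  · exact (hk 2 ![x, y]).isHermitian.apply 0 1
  · let e : Fin v.support.card ≃ v.support := v.support.equivFin.symm
    have h := (hk _ fun i => (e i : X)).dotProduct_mulVec_nonneg fun i => v (e i)
    refine h.trans_eq ?_
    simp only [dotProduct, Matrix.mulVec, Finset.mul_sum, Finsupp.sum, Pi.star_apply, mul_assoc,
      Matrix.submatrix_apply]
    rw [← Finset.sum_coe_sort v.support, ← e.sum_comp]
    refine Finset.sum_congr rfl fun i _ => ?_
    rw [← Finset.sum_coe_sort v.support, ← e.sum_comp]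

theorem IsPositiveDefinite.posSemidef {G : Type*} [Group G] {f : G → ℂ}
    (hf : IsPositiveDefinite f) : (Matrix.of fun g h => f (g⁻¹ * h)).PosSemidef :=
  posSemidef_of_forall_submatrix hf

theorem posSemidef_smul_id {k : Matrix X X ℂ} (hk : k.PosSemidef) :
    (Matrix.of fun x y => k x y • ContinuousLinearMap.id ℂ ℂ).PosSemidef := by
  have tfae := (RKHS.posSemidef_tfae
    (K := Matrix.of fun x y => k x y • ContinuousLinearMap.id ℂ ℂ)).out 0 2
  refine tfae.2 ⟨Matrix.IsHermitian.ext fun x y => ?_, fun v => ?_⟩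
  · rw [Matrix.of_apply, Matrix.of_apply, star_smul, hk.isHermitian.apply]
    exact congrArg (k x y • ·) (star_one (ℂ →L[ℂ] ℂ))
  · refine (Complex.le_def.1 ((hk.2 v).trans_eq ?_)).1
    refine Finset.sum_congr rfl fun x _ => Finset.sum_congr rfl fun y _ => ?_
    simp only [Matrix.of_apply, smul_apply, id_apply, smul_eq_mul, RCLike.inner_apply, map_mul,
      ← Complex.star_def, hk.isHermitian.apply]
    ring

theorem exists_lp_inner_eq {k : Matrix X X ℂ} (hk : k.PosSemidef) :
    ∃ (J : Type u) (η : X → lp (fun _ : J => ℂ) 2), ∀ x y, ⟪η x, η y⟫_ℂ = k x y := by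
  let A : Matrix X X (ℂ →L[ℂ] ℂ) := .of fun x y => k x y • ContinuousLinearMap.id ℂ ℂ
  have : Fact A.PosSemidef := ⟨posSemidef_smul_id hk⟩
  refine ⟨_, fun x => (onb (RKHS.OfKernel A)).repr (RKHS.kerFun (RKHS.OfKernel A) x 1),
    fun x y => ?_⟩
  rw [LinearIsometryEquiv.inner_map_map, ← RKHS.kernel_inner, RKHS.OfKernel.kernel_ofKernel]
  simp only [A, Matrix.of_apply, smul_apply, id_apply, smul_eq_mul, mul_one, RCLike.inner_apply,
    one_mul, ← Complex.star_def, hk.isHermitian.apply]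

end Kernel

section Average

open MeasureTheory

variable {X K : Type*} [MeasurableSpace X] {μ : Measure X} [NormedAddCommGroup K]
  [InnerProductSpace ℂ K] [CompleteSpace K]

theorem isPositive_integral_rankOne (v : X → K) :
    (∫ x, rankOne ℂ (v x) (v x) ∂μ).IsPositive :=
  (nonneg_iff_isPositive _).1 <| integral_nonneg fun x =>
    (nonneg_iff_isPositive _).2 (isPositive_rankOne_self (v x))

variable [TopologicalSpace X] [CompactSpace X] [BorelSpace X] [IsFiniteMeasure μ]

theorem integrable_of_continuous {E : Type*} [NormedAddCommGroup E] {F : X → E}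
    (hF : Continuous F) : Integrable F μ :=
  hF.integrable_of_hasCompactSupport (HasCompactSupport.of_compactSpace F)

variable (μ) in
theorem continuous_integral_continuousMap : Continuous fun f : C(X, ℝ) => ∫ x, f x ∂μ :=
  (continuous_integral.comp (ContinuousMap.toLp 1 μ ℝ).continuous).congr fun f =>
    integral_congr_ae (ContinuousMap.coeFn_toLp μ f)

/- The index set may be uncountable, so dominated convergence is not available; Dini's theorem
is used instead. -/
theorem hasSum_integral_of_nonneg {ι : Type*} {F : ι → C(X, ℝ)} {f : C(X, ℝ)} (hF : ∀ i, 0 ≤ F i)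
    (hf : ∀ x, HasSum (fun i => F i x) (f x)) :
    HasSum (fun i => ∫ x, F i x ∂μ) (∫ x, f x ∂μ) := by
  have hDini : HasSum F f := ContinuousMap.tendsto_of_monotone_of_pointwise
    (fun _ _ hst => Finset.sum_le_sum_of_subset_of_nonneg hst fun i _ _ => hF i) fun x => by
      simpa only [HasSum, SummationFilter.unconditional_filter, ContinuousMap.coe_sum,
        Finset.sum_apply] using hf x
  refine (((continuous_integral_continuousMap μ).tendsto f).comp hDini).congr fun s => ?_
  simp only [Function.comp_apply, ContinuousMap.coe_sum, Finset.sum_apply]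
  exact integral_finsetSum s fun i _ => integrable_of_continuous (F i).continuous

theorem inner_integral_rankOne_self {v : X → K} (hv : Continuous v) (y : K) :
    ⟪y, (∫ x, rankOne ℂ (v x) (v x) ∂μ) y⟫_ℂ = ((∫ x, ‖⟪y, v x⟫_ℂ‖ ^ 2 ∂μ : ℝ) : ℂ) := by
  have hcont : Continuous fun x => rankOne ℂ (v x) (v x) :=
    (smulRightL ℂ K K).continuous₂.comp (((innerSL ℂ).continuous.comp hv).prodMk hv)
  have hpoint (x : X) : ⟪y, rankOne ℂ (v x) (v x) y⟫_ℂ = ((‖⟪y, v x⟫_ℂ‖ ^ 2 : ℝ) : ℂ) := by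
    rw [← toReal_enorm, ← ENNReal.toReal_pow]
    exact inner_pureState_apply_self (v x) y
  rw [← integral_complex_ofReal]
  simp only [← hpoint]
  exact (((innerSL ℂ y) ∘L (ContinuousLinearMap.apply ℂ K y)).integral_comp_comm
    (integrable_of_continuous hcont)).symm

theorem hasSum_inner_integral_rankOne {v : X → K} (hv : Continuous v) :
    HasSum (fun k => ⟪onb K k, (∫ x, rankOne ℂ (v x) (v x) ∂μ) (onb K k)⟫_ℂ)
      ((∫ x, ‖v x‖ ^ 2 ∂μ : ℝ) : ℂ) := by
  simp only [inner_integral_rankOne_self hv]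
  refine Complex.hasSum_ofReal.2 (hasSum_integral_of_nonneg
    (F := fun k => ⟨fun x => ‖⟪onb K k, v x⟫_ℂ‖ ^ 2, by fun_prop⟩)
    (f := ⟨fun x => ‖v x‖ ^ 2, by fun_prop⟩) (fun k x => sq_nonneg _) fun x => ?_)
  change HasSum (fun k => ‖⟪onb K k, v x⟫_ℂ‖ ^ 2) (‖v x‖ ^ 2)
  have h : HasSum (fun k => ((‖⟪onb K k, v x⟫_ℂ‖ₑ ^ 2).toReal : ℂ)) _ :=
    hasSum_ofReal_toReal ((tsum_enorm_inner_sq (onb K) (v x)).trans_ne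
      (ENNReal.pow_ne_top enorm_ne_top))
  rw [tsum_enorm_inner_sq] at h
  simpa only [ENNReal.toReal_pow, toReal_enorm] using Complex.hasSum_ofReal.1 h

end Average

section InvariantState

open MeasureTheory

variable {G : Type*} [Group G] [TopologicalSpace G]
  {K : Type*} [NormedAddCommGroup K] [InnerProductSpace ℂ K] [CompleteSpace K]

/-- The representation `V` fixes a density operator: a positive operator of trace one that
commutes with every `V g`. -/
def HasInvariantState (V : UnitaryRep G K) : Prop :=
  ∃ ρ : traceClass K, ρ.1.IsPositive ∧ trace ρ = 1 ∧ ∀ g, conj (V.toHom g) ρ = ρ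

theorem conj_eq_self_of_inner_eq {V : UnitaryRep G K} {ρ : traceClass K}
    (h : ∀ g y, ⟪V g y, ρ.1 (V g y)⟫_ℂ = ⟪y, ρ.1 y⟫_ℂ) (g : G) : conj (V.toHom g) ρ = ρ := by
  refine Subtype.ext (ext_inner_self fun y => ?_)
  rw [inner_conj_apply, V.star_toHom, h]

theorem hasInvariantState_of_compactSpace [IsTopologicalGroup G] [CompactSpace G]
    (V : UnitaryRep G K) {φ : K} (hφ : ‖φ‖ = 1) : HasInvariantState V := by
  let : MeasurableSpace G := borel G
  have : BorelSpace G := ⟨rfl⟩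
  let μ : Measure G := Measure.haarMeasure ⊤
  have : IsProbabilityMeasure μ := ⟨Measure.haarMeasure_self (K₀ := ⊤)⟩
  have hV : Continuous fun g => V g φ := V.continuous_apply φ
  have htrace := hasSum_inner_integral_rankOne (μ := μ) hV
  refine ⟨⟨∫ g, rankOne ℂ (V g φ) (V g φ) ∂μ, Submodule.subset_span <|
    mem_positiveTraceClass_of_hasSum (isPositive_integral_rankOne _) htrace⟩,
    isPositive_integral_rankOne _, htrace.tsum_eq.trans ?_,
    conj_eq_self_of_inner_eq fun g y => ?_⟩
  · simp only [V.norm_apply, hφ, one_pow, integral_const, probReal_univ, one_smul,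
      Complex.ofReal_one]
  · simp only [inner_integral_rankOne_self hV, V.inner_apply_left, ← V.mul_apply]
    rw [integral_mul_left_eq_self (μ := μ) (fun h => ‖⟪y, V h φ⟫_ℂ‖ ^ 2) g⁻¹]

theorem HasInvariantState.exists_hilbertSchmidt {V : UnitaryRep G K} (hV : HasInvariantState V) :
    ∃ S : K →L[ℂ] K, hsNormSq S = 1 ∧ ∀ g y, ‖adjoint S (V g y)‖ₑ = ‖adjoint S y‖ₑ := by
  obtain ⟨ρ, hpos, htr, hinv⟩ := hV
  obtain ⟨S, hS, rfl⟩ := exists_eq_mulAdjoint hpos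
  refine ⟨S, ?_, fun g y => ?_⟩
  · rw [trace_mulAdjoint] at htr
    rw [← ENNReal.toReal_eq_one_iff]
    exact_mod_cast htr
  · have h : ⟪y, (conj (V.toHom g⁻¹) (mulAdjoint S hS)).1 y⟫_ℂ = ⟪y, (mulAdjoint S hS).1 y⟫_ℂ := by
      rw [hinv]
    rw [inner_conj_apply, V.star_toHom, inv_inv] at h
    have hsq := (inner_comp_adjoint_self S _).symm.trans (h.trans (inner_comp_adjoint_self S y))
    rw [Complex.ofReal_inj, ENNReal.toReal_eq_toReal_iff' (ENNReal.pow_ne_top enorm_ne_top)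
      (ENNReal.pow_ne_top enorm_ne_top)] at hsq
    exact (ENNReal.pow_right_strictMono two_ne_zero).injective hsq

end InvariantState

section MeasurePrepare

variable {H H' K K' : Type*} [NormedAddCommGroup H] [InnerProductSpace ℂ H] [CompleteSpace H]
  [NormedAddCommGroup H'] [InnerProductSpace ℂ H'] [CompleteSpace H']
  [NormedAddCommGroup K] [InnerProductSpace ℂ K] [NormedAddCommGroup K'] [InnerProductSpace ℂ K']
  [CompleteSpace K']

/-- Kraus operators `|S fₖ⟩⟨Q† eᵢ|` of the measure-and-prepare map `T ↦ tr(Q T Q†) S S†`. -/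
def measurePrepare (Q : H →L[ℂ] H') (S : K' →L[ℂ] K) (p : basisIndex H' × basisIndex K') :
    H →L[ℂ] K :=
  rankOne ℂ (S (onb K' p.2)) (adjoint Q (onb H' p.1))

theorem measurePrepare_apply (Q : H →L[ℂ] H') (S : K' →L[ℂ] K)
    (p : basisIndex H' × basisIndex K') (x : H) :
    measurePrepare Q S p x = ⟪onb H' p.1, Q x⟫_ℂ • S (onb K' p.2) := by
  rw [← adjoint_inner_left]
  rfl

theorem tsum_prod_mul {α β : Type*} (F : α → ENNReal) (F' : β → ENNReal) :
    ∑' p : α × β, F p.1 * F' p.2 = (∑' a, F a) * ∑' b, F' b := by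
  rw [ENNReal.tsum_prod (f := fun a b => F a * F' b)]
  simp only [ENNReal.tsum_mul_left, ENNReal.tsum_mul_right]

theorem tsum_enorm_measurePrepare_apply_sq (Q : H →L[ℂ] H') (S : K' →L[ℂ] K) (x : H) :
    ∑' p, ‖measurePrepare Q S p x‖ₑ ^ 2 = ‖Q x‖ₑ ^ 2 * hsNormSq S := by
  simp only [measurePrepare_apply, enorm_smul, mul_pow]
  rw [tsum_prod_mul (fun i => ‖⟪onb H' i, Q x⟫_ℂ‖ₑ ^ 2) fun k => ‖S (onb K' k)‖ₑ ^ 2,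
    tsum_enorm_inner_sq, hsNormSq]

theorem krausForm_measurePrepare [CompleteSpace K] (Q : H →L[ℂ] H') (S : K' →L[ℂ] K) (x : H)
    (y : K) : krausForm (measurePrepare Q S) x y = ‖Q x‖ₑ ^ 2 * ‖adjoint S y‖ₑ ^ 2 := by
  have hS (k) : ‖⟪y, S (onb K' k)⟫_ℂ‖ₑ = ‖⟪onb K' k, adjoint S y⟫_ℂ‖ₑ := by
    rw [adjoint_inner_right, enorm_inner_symm]
  simp only [krausForm, measurePrepare_apply, inner_smul_right, enorm_mul, mul_pow, hS]
  rw [tsum_prod_mul (fun i => ‖⟪onb H' i, Q x⟫_ℂ‖ₑ ^ 2)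
    fun k => ‖⟪onb K' k, adjoint S y⟫_ℂ‖ₑ ^ 2, tsum_enorm_inner_sq, tsum_enorm_inner_sq]

end MeasurePrepare

section Entries

open scoped lp

variable {J H K : Type*} [NormedAddCommGroup H] [InnerProductSpace ℂ H]
  [NormedAddCommGroup K] [InnerProductSpace ℂ K]

/-- The entries `Wⱼ : H → K` of an operator `H → ℓ²(J, K)`: the Kraus operators of the
Stinespring form `T ↦ tr_{ℓ²(J)}(A T A†)`. -/
def entries (A : H →L[ℂ] lp (fun _ : J => K) 2) (j : J) : H →L[ℂ] K :=
  lp.evalCLM ℂ (fun _ : J => K) 2 j ∘L A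

theorem tsum_enorm_entries_apply_sq (A : H →L[ℂ] lp (fun _ : J => K) 2) (x : H) :
    ∑' j, ‖entries A j x‖ₑ ^ 2 = ‖A x‖ₑ ^ 2 :=
  tsum_enorm_sq_lp (A x)

theorem krausForm_entries (A : H →L[ℂ] lp (fun _ : J => K) 2) (x : H) (y : K) :
    krausForm (entries A) x y = ‖lpMap (innerSL ℂ y) (A x)‖ₑ ^ 2 :=
  tsum_enorm_sq_lp (lpMap (innerSL ℂ y) (A x))

end Entries

section Projection

variable {H K : Type*} [NormedAddCommGroup H] [InnerProductSpace ℂ H]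
  [NormedAddCommGroup K] [NormedSpace ℂ K]
  {M : Submodule ℂ H} [M.HasOrthogonalProjection]

theorem apply_starProjection_eq_of_norm_apply_eq {A : H →L[ℂ] K}
    (hA : ∀ x, ‖A x‖ = ‖M.starProjection x‖) (x : H) :
    A (M.starProjection x) = A x := by
  rw [← sub_eq_zero, ← map_sub, ← norm_eq_zero, hA, map_sub,
    Submodule.starProjection_eq_self_iff.2 (Submodule.starProjection_apply_mem _ x), sub_self,
    norm_zero]

variable (M) in
theorem enorm_sq_starProjection_add_orthogonal (x : H) :
    ‖M.starProjection x‖ₑ ^ 2 + ‖Mᗮ.starProjection x‖ₑ ^ 2 = ‖x‖ₑ ^ 2 := by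
  simp only [← ofReal_norm, ← ENNReal.ofReal_pow (norm_nonneg _)]
  rw [← ENNReal.ofReal_add (sq_nonneg _) (sq_nonneg _),
    ← Submodule.norm_sq_eq_add_norm_sq_starProjection]

end Projection

section Cyclic

open scoped lp

universe u

variable {G : Type u} [Group G] [TopologicalSpace G]
  {H K : Type*} [NormedAddCommGroup H] [InnerProductSpace ℂ H] [CompleteSpace H]
  [NormedAddCommGroup K] [InnerProductSpace ℂ K] [CompleteSpace K]

theorem norm_lpMap_inner_apply_eq {J : Type*} {U : UnitaryRep G H} {V : UnitaryRep G K} {ψ : H}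
    {φ : K} {η : G → lp (fun _ : J => ℂ) 2} {A : H →L[ℂ] lp (fun _ : J => K) 2}
    (hA : ∀ g, A (U g ψ) = lpTensor (η g) (V g φ))
    (hη : ∀ g h k, ⟪η (g * h), η (g * k)⟫_ℂ = ⟪η h, η k⟫_ℂ) (g : G) (y : K) {x : H}
    (hx : x ∈ cyclicSubspace U ψ) :
    ‖lpMap (innerSL ℂ (V g y)) (A (U g x))‖ = ‖lpMap (innerSL ℂ y) (A x)‖ := by
  refine norm_apply_eq_of_inner_eq (a := fun h => U h ψ)
    (A := lpMap (innerSL ℂ (V g y)) ∘L A ∘L U g) (B := lpMap (innerSL ℂ y) ∘L A)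
    (fun h k => ?_) hx
  have hV (h : G) : ⟪V g y, V (g * h) φ⟫_ℂ = ⟪y, V h φ⟫_ℂ := by
    rw [V.inner_apply_left, ← V.mul_apply, inv_mul_cancel_left]
  simp only [comp_apply, ← U.mul_apply, hA, lpMap_innerSL_lpTensor, inner_smul_left,
    inner_smul_right, hV, hη]

/- The vectors `η g ⊗ V g φ`, with `⟪η g, η h⟫ = f (g⁻¹ h)`, have the same Gram matrix as the
orbit `U g ψ`; the Kraus operators are the entries of the partial isometry between them. -/
theorem exists_krausForm_cyclicSubspace {U : UnitaryRep G H} {V : UnitaryRep G K} {ψ : H} {φ : K}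
    {f : G → ℂ} (hf : IsPositiveDefinite f) (hf1 : f 1 = 1)
    (hχ : ∀ g, charFn U ψ g = charFn V φ g * f g) :
    ∃ (J : Type u) (W : J → H →L[ℂ] K),
      (∀ x, ∑' j, ‖W j x‖ₑ ^ 2 = ‖(cyclicSubspace U ψ).starProjection x‖ₑ ^ 2) ∧
      (∀ g x y, krausForm W (U g x) (V g y) = krausForm W x y) ∧
      ∀ y, krausForm W ψ y = ‖⟪y, φ⟫_ℂ‖ₑ ^ 2 := by
  obtain ⟨J, η, hη⟩ := exists_lp_inner_eq hf.posSemidef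
  simp only [Matrix.of_apply] at hη
  have hgram (g h : G) :
      ⟪U g ψ, U h ψ⟫_ℂ = ⟪lpTensor (η g) (V g φ), lpTensor (η h) (V h φ)⟫_ℂ := by
    rw [U.inner_apply_apply, hχ, inner_lpTensor, hη, V.inner_apply_apply, mul_comm]
  obtain ⟨A, hA, hnorm⟩ := exists_partialIsometry hgram
  have hηinv (g h k : G) : ⟪η (g * h), η (g * k)⟫_ℂ = ⟪η h, η k⟫_ℂ := by
    rw [hη, hη, mul_inv_rev, mul_assoc, inv_mul_cancel_left]
  have hη1 : ‖η 1‖ = 1 := by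
    rw [norm_eq_sqrt_re_inner (𝕜 := ℂ), hη, inv_one, one_mul, hf1,
      RCLike.one_re, Real.sqrt_one]
  have hAP : ∀ x, A ((cyclicSubspace U ψ).starProjection x) = A x :=
    apply_starProjection_eq_of_norm_apply_eq hnorm
  refine ⟨J, entries A, fun x => ?_, fun g x y => ?_, fun y => ?_⟩
  · rw [tsum_enorm_entries_apply_sq, enorm_eq_iff_norm_eq.2 (hnorm x)]
    rfl
  · rw [krausForm_entries, krausForm_entries, ← hAP (U g x), ← hAP x,
      starProjection_cyclicSubspace_apply, enorm_eq_iff_norm_eq.2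
        (norm_lpMap_inner_apply_eq hA hηinv g y (Submodule.starProjection_apply_mem _ x))]
  · have hψ : A ψ = lpTensor (η 1) φ := by simpa only [U.one_apply, V.one_apply] using hA 1
    rw [krausForm_entries, hψ, lpMap_innerSL_lpTensor, enorm_smul, ← ofReal_norm (η 1), hη1,
      ENNReal.ofReal_one, mul_one]

theorem norm_starProjection_cyclicSubspace_orthogonal_apply (U : UnitaryRep G H) (ψ : H) (g : G)
    (x : H) : ‖(cyclicSubspace U ψ)ᗮ.starProjection (U g x)‖ =
      ‖(cyclicSubspace U ψ)ᗮ.starProjection x‖ := by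
  rw [Submodule.starProjection_orthogonal_val, Submodule.starProjection_orthogonal_val,
    starProjection_cyclicSubspace_apply, ← map_sub, U.norm_apply]

theorem starProjection_cyclicSubspace_orthogonal_self (U : UnitaryRep G H) (ψ : H) :
    (cyclicSubspace U ψ)ᗮ.starProjection ψ = 0 := by
  rw [Submodule.starProjection_orthogonal_val,
    Submodule.starProjection_eq_self_iff.2 (self_mem_cyclicSubspace U ψ), sub_self]

theorem covariantlyConvertible_of_isPositiveDefinite {U : UnitaryRep G H} {V : UnitaryRep G K}
    (hV : HasInvariantState V) {ψ : H} {φ : K} {f : G → ℂ} (hf : IsPositiveDefinite f)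
    (hf1 : f 1 = 1) (hχ : ∀ g, charFn U ψ g = charFn V φ g * f g) :
    CovariantlyConvertible U V (pureState ψ) (pureState φ) := by
  obtain ⟨J, W, hWnorm, hWinv, hWψ⟩ := exists_krausForm_cyclicSubspace hf hf1 hχ
  obtain ⟨S, hS, hSinv⟩ := hV.exists_hilbertSchmidt
  let Q : H →L[ℂ] H := (cyclicSubspace U ψ)ᗮ.starProjection
  have hQinv (g : G) (x : H) : ‖Q (U g x)‖ₑ = ‖Q x‖ₑ :=
    enorm_eq_iff_norm_eq.2 (norm_starProjection_cyclicSubspace_orthogonal_apply U ψ g x)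
  have hkraus : IsKrausFamily (Sum.elim W (measurePrepare Q S)) := fun x => by
    refine (Summable.tsum_sum ENNReal.summable ENNReal.summable).trans ?_
    simp only [Sum.elim_inl, Sum.elim_inr]
    rw [hWnorm, tsum_enorm_measurePrepare_apply_sq, hS, mul_one,
      enorm_sq_starProjection_add_orthogonal]
  refine ⟨hkraus.channel, hkraus.isQuantumChannel, hkraus.isCovariant_channel fun g x y => ?_,
    hkraus.channel_pureState fun y => ?_⟩
  · rw [krausForm_sumElim, krausForm_sumElim, hWinv, krausForm_measurePrepare,
      krausForm_measurePrepare, hQinv, hSinv]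
  · rw [krausForm_sumElim, hWψ, krausForm_measurePrepare,
      starProjection_cyclicSubspace_orthogonal_self, enorm_zero, zero_pow two_ne_zero, zero_mul,
      add_zero]

end Cyclic

end CovariantConversion

end

theorem theorem4_general {G : Type*} [Group G] [TopologicalSpace G]
    {H K : Type*} [NormedAddCommGroup H] [InnerProductSpace ℂ H] [CompleteSpace H]
    [NormedAddCommGroup K] [InnerProductSpace ℂ K] [CompleteSpace K]
    (U : CovariantConversion.UnitaryRep G H) (V : CovariantConversion.UnitaryRep G K)
    (hV : CovariantConversion.HasInvariantState V) (ψ : H) (hψ : ‖ψ‖ = 1) (φ : K) (hφ : ‖φ‖ = 1) :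
    CovariantConversion.CovariantlyConvertible U V
        (CovariantConversion.pureState ψ) (CovariantConversion.pureState φ) ↔
      ∃ f : G → ℂ, CovariantConversion.IsPositiveDefinite f ∧
        ∀ g : G, CovariantConversion.charFn U ψ g = CovariantConversion.charFn V φ g * f g := by
  constructor
  · rintro ⟨E, hE, hcov, hEψ⟩
    exact ⟨_, CovariantConversion.isPositiveDefinite_coherenceFn hE.1 hcov ψ φ,
      CovariantConversion.charFn_eq_mul_coherenceFn hE hcov hφ hEψ⟩
  · rintro ⟨f, hf, hχ⟩
    have hf1 : f 1 = 1 := by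
      simpa only [CovariantConversion.charFn_one _ hψ, CovariantConversion.charFn_one _ hφ,
        one_mul] using (hχ 1).symm
    exact CovariantConversion.covariantlyConvertible_of_isPositiveDefinite hV hf hf1 hχ

theorem theorem4 {G : Type*} [Group G] [TopologicalSpace G] [IsTopologicalGroup G]
    [CompactSpace G] [T2Space G]
    {H K : Type*} [NormedAddCommGroup H] [InnerProductSpace ℂ H] [CompleteSpace H]
    [NormedAddCommGroup K] [InnerProductSpace ℂ K] [CompleteSpace K]
    (U : CovariantConversion.UnitaryRep G H) (V : CovariantConversion.UnitaryRep G K)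
    (ψ : H) (hψ : ‖ψ‖ = 1) (φ : K) (hφ : ‖φ‖ = 1) :
    CovariantConversion.CovariantlyConvertible U V
        (CovariantConversion.pureState ψ) (CovariantConversion.pureState φ) ↔
      ∃ f : G → ℂ, CovariantConversion.IsPositiveDefinite f ∧
        ∀ g : G, CovariantConversion.charFn U ψ g = CovariantConversion.charFn V φ g * f g :=
  theorem4_general U V (CovariantConversion.hasInvariantState_of_compactSpace V hφ) ψ hψ φ hφ
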